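/- **Theorem 5.2.** The *localization game* with $k$ cops on a finite connected simple graph $G$ is played as follows. The Robber secretly chooses a vertex of $G$. In each turn the Cop probes $k$ vertices $b_1,\dots,b_k$ (which may depend on all answers received so far) and receives the vector of distances $(d_G(r,b_1),\dots,d_G(r,b_k))$, where $r$ is the Robber's current vertex. If the distance vectors received up to and including this turn, together with the rules of the game, determine the Robber's current vertex $r$, then the Robber is located and the Cop wins. Otherwise the Robber either stays at $r$ or moves to a neighbour of $r$, and the next turn begins. The Cop has a winning strategy if she can ensure that the Robber is located after finitely many turns, irrespective of the Robber's moves. The *localization number* $\zeta(G)$ is the least positive integer $k$ for which the Cop has a winning strategy with $k$ cops. Let $C_m$ denote the cycle on $m$ vertices and $\square$ the Cartesian product of graphs. Let $m,n$ be integers with $m\ge n\ge 3$. If $m=n=3$, or if $m$ is even and $n=4$, then $\zeta(C_m\,\square\, C_n)=3$. Otherwise, $\zeta(C_m\,\square\, C_n)=2$. -/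

import Mathlib

namespace SimpleGraph

/-- A trajectory of the Robber: `r t` is the Robber's vertex when the probe of turn `t` is made.
The initial vertex is arbitrary; between two turns the Robber stays or moves to a neighbour. -/
def IsRobberTrajectory {V : Type*} (G : SimpleGraph V) (r : ℕ → V) : Prop :=
  ∀ t, r (t + 1) = r t ∨ G.Adj (r t) (r (t + 1))

/-- A (deterministic, adaptive) strategy for a Cop with `k` cops: the list of all distance vectors
received so far (in chronological order) determines the `k` vertices that are probed next. -/
abbrev CopStrategy (V : Type*) (k : ℕ) : Type _ :=
  List (Fin k → ℕ) → (Fin k → V)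

/-- The list of the distance vectors received in the first `t` turns (turns `0, …, t - 1`)
when the Cop follows the strategy `σ` and the Robber follows the trajectory `r`. -/
noncomputable def probeAnswers {V : Type*} (G : SimpleGraph V) {k : ℕ} (σ : CopStrategy V k)
    (r : ℕ → V) : ℕ → List (Fin k → ℕ)
  | 0 => []
  | t + 1 => probeAnswers G σ r t ++ [fun i => G.dist (r t) (σ (probeAnswers G σ r t) i)]

/-- The Cop knows the Robber's exact position after the probe of turn `t`: every possible
trajectory that produces the same distance vectors in turns `0, …, t` is at the same
vertex in turn `t`. -/
def IsLocatedAt {V : Type*} (G : SimpleGraph V) {k : ℕ} (σ : CopStrategy V k)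
    (r : ℕ → V) (t : ℕ) : Prop :=
  ∀ r' : ℕ → V, G.IsRobberTrajectory r' →
    probeAnswers G σ r' (t + 1) = probeAnswers G σ r (t + 1) → r' t = r t

/-- `k` cops suffice: some strategy locates the Robber after finitely many turns, whatever the
Robber does. -/
def CopWins {V : Type*} (G : SimpleGraph V) (k : ℕ) : Prop :=
  ∃ σ : CopStrategy V k, ∀ r : ℕ → V, G.IsRobberTrajectory r → ∃ t, G.IsLocatedAt σ r t

/-- The localization number `ζ(G)` of a connected graph: the least positive number of cops
for which the Cop has a winning strategy in the localization game. -/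
noncomputable def localizationNumber {V : Type*} (G : SimpleGraph V) : ℕ :=
  sInf {k : ℕ | 0 < k ∧ G.CopWins k}

end SimpleGraph

/-!
What the Cop knows is a set of vertices: a probe splits it into answer classes, and the Robber's
move replaces the surviving class by its closed neighbourhood.

If `m` is odd, two probes at almost antipodal vertices of one row determine the Robber's column,
and his height up to reflection in that row. After his move, probes antipodal to that column from
either side, at consecutive heights, leave no ambiguity, provided that no two candidate heights are
exchanged by the reflection that exchanges the two probe heights; such a pair of heights exists as
soon as `4 ≤ n`. If `m` and `n` are even and at least `6`, probes at antipodal vertices of one row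
reveal the Robber's distance to them in each coordinate. By parity, the next probe leaves at most
two opposite corners of a face, whose neighbourhood fits into a `4 × 4` box, and probes at two
corners of that box tell all its vertices apart.

For the lower bounds, the Robber needs a family of knowledge sets that he can always remain in;
by König's lemma he then has an infinite trajectory that is never located. On `C_m □ C_4` with `m`
even, the first two columns split by parity into two sets of four vertices. Every probe is
equidistant from at least three vertices of each of them, so two probes leave two vertices of one
undistinguished, and any two vertices of one dominate the other. On `C_3 □ C_3`, any two vertices
dominate at least seven, whereas two probes have at most six answers.
-/

namespace LocalizationGame

open SimpleGraph

section Game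

variable {V W : Type*} {G : SimpleGraph V} {k : ℕ}

/-- The closed neighbourhood `N[S]` of a set of vertices: where a Robber who was in `S` can be one
turn later. -/
def closedNeighborSet (G : SimpleGraph V) (S : Set V) : Set V :=
  {w | ∃ v ∈ S, w = v ∨ G.Adj v w}

/-- The vertices of `S` that answer the distance vector `a` to the probe `p`. -/
def answerClass (G : SimpleGraph V) (p : Fin k → V) (S : Set V) (a : Fin k → ℕ) : Set V :=
  {w ∈ S | ∀ i, G.dist w (p i) = a i}

/-- The Cop wins with `k` cops once she knows that the Robber is in `S`. -/
def CopWinsFrom (G : SimpleGraph V) (k : ℕ) (S : Set V) : Prop :=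
  ∃ σ : CopStrategy V k, ∀ r, G.IsRobberTrajectory r → r 0 ∈ S →
    ∃ t, ∀ r', G.IsRobberTrajectory r' → r' 0 ∈ S →
      probeAnswers G σ r' (t + 1) = probeAnswers G σ r (t + 1) → r' t = r t

lemma closedNeighborSet_mono {S T : Set V} (h : S ⊆ T) :
    closedNeighborSet G S ⊆ closedNeighborSet G T :=
  fun _ ⟨v, hv, hvw⟩ => ⟨v, h hv, hvw⟩

lemma CopWinsFrom.mono {S T : Set V} (hT : CopWinsFrom G k T) (hST : S ⊆ T) :
    CopWinsFrom G k S := by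
  obtain ⟨σ, hσ⟩ := hT
  refine ⟨σ, fun r hr hrS => ?_⟩
  obtain ⟨t, ht⟩ := hσ r hr (hST hrS)
  exact ⟨t, fun r' hr' hr'S => ht r' hr' (hST hr'S)⟩

lemma CopWinsFrom.copWins (h : CopWinsFrom G k Set.univ) : G.CopWins k := by
  obtain ⟨σ, hσ⟩ := h
  refine ⟨σ, fun r hr => ?_⟩
  obtain ⟨t, ht⟩ := hσ r hr trivial
  exact ⟨t, fun r' hr' => ht r' hr' trivial⟩

lemma probeAnswers_succ_eq_cons (σ : CopStrategy V k) (r : ℕ → V) (t : ℕ) :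
    probeAnswers G σ r (t + 1) = (fun i => G.dist (r 0) (σ [] i)) ::
      probeAnswers G (fun L => σ ((fun i => G.dist (r 0) (σ [] i)) :: L))
        (fun s => r (s + 1)) t := by
  induction t with
  | zero => rfl
  | succ t ih => rw [probeAnswers, ih, probeAnswers, List.cons_append]

theorem copWinsFrom_of_probe {S : Set V} (p : Fin k → V)
    (hp : ∀ a, (answerClass G p S a).Subsingleton ∨
      CopWinsFrom G k (closedNeighborSet G (answerClass G p S a))) :
    CopWinsFrom G k S := by
  have hτ : ∀ a, ∃ τ : CopStrategy V k, (answerClass G p S a).Subsingleton ∨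
      ∀ r, G.IsRobberTrajectory r → r 0 ∈ closedNeighborSet G (answerClass G p S a) →
        ∃ t, ∀ r', G.IsRobberTrajectory r' →
          r' 0 ∈ closedNeighborSet G (answerClass G p S a) →
          probeAnswers G τ r' (t + 1) = probeAnswers G τ r (t + 1) → r' t = r t := fun a =>
    (hp a).elim (fun h => ⟨fun _ => p, .inl h⟩) fun ⟨τ, h⟩ => ⟨τ, .inr h⟩
  choose τ hτ using hτ
  let σ : CopStrategy V k
    | [] => p
    | a :: L => τ a L
  refine ⟨σ, fun r hr hrS => ?_⟩
  set a : Fin k → ℕ := fun i => G.dist (r 0) (p i)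
  have hclass : ∀ r' : ℕ → V, r' 0 ∈ S → (fun i => G.dist (r' 0) (p i)) = a →
      r' 0 ∈ answerClass G p S a := fun r' h h' => ⟨h, congrFun h'⟩
  have htail : ∀ r' : ℕ → V, G.IsRobberTrajectory r' →
      G.IsRobberTrajectory fun s => r' (s + 1) := fun r' h t => h (t + 1)
  have hfirst : ∀ r' t, probeAnswers G σ r' (t + 1) = probeAnswers G σ r (t + 1) →
      (fun i => G.dist (r' 0) (p i)) = a ∧
      probeAnswers G (τ a) (fun s => r' (s + 1)) t =
        probeAnswers G (τ a) (fun s => r (s + 1)) t := by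
    intro r' t he
    rw [probeAnswers_succ_eq_cons, probeAnswers_succ_eq_cons σ r] at he
    obtain ⟨ha, hL⟩ := List.cons.inj he
    rw [ha] at hL
    exact ⟨ha, hL⟩
  rcases hτ a with h | h
  · exact ⟨0, fun r' _ hr'S he =>
      h (hclass r' hr'S (hfirst r' 0 he).1) (hclass r hrS rfl)⟩
  · have hnext : ∀ r' : ℕ → V, G.IsRobberTrajectory r' → r' 0 ∈ answerClass G p S a →
        r' (0 + 1) ∈ closedNeighborSet G (answerClass G p S a) :=
      fun r' hr' h' => ⟨r' 0, h', hr' 0⟩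
    obtain ⟨t, ht⟩ := h _ (htail r hr) (hnext r hr (hclass r hrS rfl))
    refine ⟨t + 1, fun r' hr' hr'S he => ?_⟩
    obtain ⟨ha, hL⟩ := hfirst r' (t + 1) he
    exact ht _ (htail r' hr') (hnext r' hr' (hclass r' hr'S ha)) hL

lemma copWins_of_probe (p : Fin k → V) (hp : ∀ v, CopWinsFrom G k
    (closedNeighborSet G {w | ∀ i, G.dist w (p i) = G.dist v (p i)})) : G.CopWins k := by
  refine (copWinsFrom_of_probe p fun a => ?_).copWins
  rcases (answerClass G p Set.univ a).eq_empty_or_nonempty with hempty | ⟨v, hv⟩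
  · exact .inl (hempty ▸ Set.subsingleton_empty)
  · exact .inr ((hp v).mono (closedNeighborSet_mono fun w hw i => (hw.2 i).trans (hv.2 i).symm))

lemma copWinsFrom_of_injOn {S : Set V} (p : Fin k → V)
    (hp : S.InjOn fun v i => G.dist v (p i)) : CopWinsFrom G k S :=
  copWinsFrom_of_probe p fun _ => .inl fun _ hu _ hw =>
    hp hu.1 hw.1 (funext fun i => (hu.2 i).trans (hw.2 i).symm)

lemma exists_seq_map_succ_eq {α : ℕ → Type*} [∀ t, Finite (α t)] [∀ t, Nonempty (α t)]
    (f : ∀ t, α (t + 1) → α t) : ∃ s : ∀ t, α t, ∀ t, f t (s (t + 1)) = s t := by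
  let F := CategoryTheory.Functor.ofOpSequence (C := Type _) (X := α) fun t => TypeCat.ofHom (f t)
  have : ∀ j, Finite (F.obj j) := fun j => inferInstanceAs (Finite (α j.unop))
  have : ∀ j, Nonempty (F.obj j) := fun j => inferInstanceAs (Nonempty (α j.unop))
  obtain ⟨s, hs⟩ := nonempty_sections_of_finite_inverse_system F
  refine ⟨fun t => s (.op t), fun t => ?_⟩
  have := hs (CategoryTheory.homOfLE t.le_succ).op
  rw [CategoryTheory.Functor.ofOpSequence_map_homOfLE_succ] at this
  exact this

lemma exists_trajectory_of_subset_closedNeighborSet {S : ℕ → Set V}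
    (hS : ∀ t, S (t + 1) ⊆ closedNeighborSet G (S t)) (t : ℕ) {v : V} (hv : v ∈ S t) :
    ∃ r, G.IsRobberTrajectory r ∧ (∀ j ≤ t, r j ∈ S j) ∧ r t = v := by
  induction t generalizing v with
  | zero => exact ⟨fun _ => v, fun _ => .inl rfl, fun j hj => by rwa [Nat.le_zero.mp hj], rfl⟩
  | succ t ih =>
    obtain ⟨u, hu, huv⟩ := hS t hv
    obtain ⟨r, hr, hrS, rfl⟩ := ih hu
    refine ⟨fun j => if j ≤ t then r j else v, fun j => ?_, fun j hj => ?_, by simp⟩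
    · rcases lt_trichotomy j t with h | rfl | h
      · simpa only [if_pos h.le, if_pos (Nat.succ_le_of_lt h)] using hr j
      · simpa using huv
      · exact .inl (by simp only [if_neg h.not_ge, if_neg (h.trans j.lt_succ_self).not_ge])
    · rcases Nat.le_succ_iff.mp hj with h | rfl
      · simpa only [if_pos h] using hrS j h
      · simpa using hv

lemma exists_trajectory_forall_mem {S : ℕ → Set V}
    (hS : ∀ t, S (t + 1) ⊆ closedNeighborSet G (S t)) (hfin : ∀ t, (S t).Finite)
    (hne : ∀ t, (S t).Nonempty) : ∃ r, G.IsRobberTrajectory r ∧ ∀ t, r t ∈ S t := by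
  have hpred : ∀ t (v : S (t + 1)), ∃ u : S t, v = (u : V) ∨ G.Adj u v := fun t v => by
    obtain ⟨u, hu, huv⟩ := hS t v.2
    exact ⟨⟨u, hu⟩, huv⟩
  choose f hf using hpred
  have := fun t => (hfin t).to_subtype
  have := fun t => (hne t).to_subtype
  obtain ⟨s, hs⟩ := exists_seq_map_succ_eq (α := fun t => S t) f
  refine ⟨fun t => s t, fun t => ?_, fun t => (s t).2⟩
  simpa only [hs] using hf t (s (t + 1))

/-- A family of possible knowledge sets within which the Robber can stay whatever `k` vertices are
probed: after each probe, some set of the family lies in the closed neighbourhood of the previous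
one and answers with a single distance vector. -/
def IsEvasive (G : SimpleGraph V) (k : ℕ) (F : Set (Set V)) : Prop :=
  ∀ S ∈ F, ∀ p : Fin k → V, ∃ T ∈ F, T ⊆ closedNeighborSet G S ∧
    ∃ a : Fin k → ℕ, ∀ v ∈ T, ∀ i, G.dist v (p i) = a i

lemma IsEvasive.exists_seq {F : Set (Set V)} (hF : IsEvasive G k F) (hne : F.Nonempty)
    (σ : CopStrategy V k) : ∃ (L : ℕ → List (Fin k → ℕ)) (S : ℕ → Set V), L 0 = [] ∧
      ∀ t, S t ∈ F ∧ S (t + 1) ⊆ closedNeighborSet G (S t) ∧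
        ∀ v ∈ S t, L (t + 1) = L t ++ [fun i => G.dist v (σ (L t) i)] := by
  obtain ⟨S₀, hS₀⟩ := hne
  choose! T hTF hTS a ha using hF
  let x : ℕ → List (Fin k → ℕ) × Set V := Nat.rec ([], S₀) fun _ x =>
    (x.1 ++ [a x.2 (σ x.1)], T x.2 (σ x.1))
  have hx : ∀ t, (x t).2 ∈ F := Nat.rec hS₀ fun t ih => hTF _ ih _
  refine ⟨fun t => (x t).1, fun t => (x (t + 1)).2, rfl, fun t => ⟨hx (t + 1), ?_, fun v hv => ?_⟩⟩
  · exact hTS _ (hx (t + 1)) _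
  · rw [funext (ha _ (hx t) _ v hv)]

lemma probeAnswers_eq_of_forall_mem {σ : CopStrategy V k} {L : ℕ → List (Fin k → ℕ)}
    {S : ℕ → Set V} (hL₀ : L 0 = [])
    (hL : ∀ t, ∀ v ∈ S t, L (t + 1) = L t ++ [fun i => G.dist v (σ (L t) i)])
    {r : ℕ → V} {t : ℕ} (hr : ∀ j < t, r j ∈ S j) : probeAnswers G σ r t = L t := by
  induction t with
  | zero => exact hL₀.symm
  | succ t ih =>
    rw [probeAnswers, ih fun j hj => hr j (hj.trans t.lt_succ_self),
      hL t _ (hr t t.lt_succ_self)]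

theorem IsEvasive.not_copWins {F : Set (Set V)} (hF : IsEvasive G k F) (hne : F.Nonempty)
    (hfin : ∀ S ∈ F, S.Finite) (hnt : ∀ S ∈ F, S.Nontrivial) : ¬ G.CopWins k := by
  rintro ⟨σ, hσ⟩
  obtain ⟨L, S, hL₀, hLS⟩ := hF.exists_seq hne σ
  have hans : ∀ {r t}, (∀ j < t, r j ∈ S j) → probeAnswers G σ r t = L t :=
    probeAnswers_eq_of_forall_mem hL₀ fun t => (hLS t).2.2
  have hS : ∀ t, S (t + 1) ⊆ closedNeighborSet G (S t) := fun t => (hLS t).2.1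
  obtain ⟨r, hr, hrS⟩ := exists_trajectory_forall_mem hS (fun t => hfin _ (hLS t).1)
    fun t => (hnt _ (hLS t).1).nonempty
  obtain ⟨t, ht⟩ := hσ r hr
  obtain ⟨v, hv, hvr⟩ := (hnt _ (hLS t).1).exists_ne (r t)
  obtain ⟨r', hr', hr'S, rfl⟩ := exists_trajectory_of_subset_closedNeighborSet hS t hv
  refine hvr (ht r' hr' ?_)
  rw [hans fun j hj => hr'S j (Nat.lt_succ_iff.mp hj), hans fun j _ => hrS j]

/-- One probe splits the closed neighbourhood of a vertex into at most three classes. -/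
theorem not_copWins_one_of_three_le_degree [Nonempty V] [G.LocallyFinite]
    (hdeg : ∀ v, 3 ≤ G.degree v) : ¬ G.CopWins 1 := by
  classical
  have hF : IsEvasive G 1 {S | S.Finite ∧ S.Nontrivial} := by
    rintro S ⟨-, hS⟩ p
    obtain ⟨u, hu⟩ := hS.nonempty
    have hmaps : ∀ v ∈ insert u (G.neighborFinset u),
        G.dist v (p 0) ∈ Finset.Icc (G.dist u (p 0) - 1) (G.dist u (p 0) + 1) := by
      intro v hv
      rw [Finset.mem_Icc]
      rcases Finset.mem_insert.mp hv with rfl | hv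
      · omega
      · have := ((G.mem_neighborFinset u v).mp hv).diff_dist_adj (u := p 0)
        rw [G.dist_comm (u := p 0), G.dist_comm (u := p 0)] at this
        omega
    obtain ⟨v, hv, w, hw, hvw, he⟩ := Finset.exists_ne_map_eq_of_card_lt_of_maps_to
      (t := Finset.Icc (G.dist u (p 0) - 1) (G.dist u (p 0) + 1)) (by
        rw [Finset.card_insert_of_notMem (by simp), card_neighborFinset_eq_degree, Nat.card_Icc]
        have := hdeg u
        omega) hmaps
    have hmem : ∀ v ∈ insert u (G.neighborFinset u), v ∈ closedNeighborSet G S := fun v hv =>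
      ⟨u, hu, by simpa using hv⟩
    refine ⟨{v, w}, ⟨Set.toFinite _, Set.nontrivial_pair hvw⟩, ?_, fun _ => G.dist w (p 0), ?_⟩
    · rintro _ (rfl | rfl)
      exacts [hmem _ hv, hmem _ hw]
    · rintro _ (rfl | rfl) i <;> rw [Subsingleton.elim i 0]
      exact he
  obtain ⟨v⟩ := ‹Nonempty V›
  obtain ⟨w, hw⟩ := (G.degree_pos_iff_exists_adj v).mp (by have := hdeg v; omega)
  exact hF.not_copWins ⟨{v, w}, Set.toFinite _, Set.nontrivial_pair hw.ne⟩ (fun _ h => h.1)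
    fun _ h => h.2

lemma dist_map_iso {H : SimpleGraph W} (φ : G ≃g H) (u v : V) :
    H.dist (φ u) (φ v) = G.dist u v := by
  rw [dist_eq_sInf, dist_eq_sInf]
  congr 1
  ext l
  constructor
  · rintro ⟨p, rfl⟩
    exact ⟨(p.map φ.symm.toHom).copy (φ.symm_apply_apply u) (φ.symm_apply_apply v), by simp⟩
  · rintro ⟨p, rfl⟩
    exact ⟨p.map φ.toHom, by simp⟩

theorem copWins_of_iso {H : SimpleGraph W} (φ : G ≃g H) (h : G.CopWins k) : H.CopWins k := by
  obtain ⟨σ, hσ⟩ := h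
  have hans : ∀ (r : ℕ → W) t, probeAnswers H (fun L i => φ (σ L i)) r t =
      probeAnswers G σ (fun s => φ.symm (r s)) t := by
    intro r t
    induction t with
    | zero => rfl
    | succ t ih =>
      simp only [probeAnswers, ih, ← dist_map_iso φ, RelIso.apply_symm_apply]
  have htraj : ∀ r : ℕ → W, H.IsRobberTrajectory r →
      G.IsRobberTrajectory fun s => φ.symm (r s) := fun r hr t =>
    (hr t).imp (congrArg φ.symm) φ.symm.map_adj_iff.mpr
  refine ⟨fun L i => φ (σ L i), fun r hr => ?_⟩
  obtain ⟨t, ht⟩ := hσ _ (htraj r hr)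
  refine ⟨t, fun r' hr' he => φ.symm.injective (ht _ (htraj r' hr') ?_)⟩
  rw [← hans, ← hans, he]

lemma localizationNumber_eq (hk : 0 < k) (hwin : G.CopWins k)
    (hmin : ∀ j, 0 < j → j < k → ¬ G.CopWins j) : G.localizationNumber = k :=
  IsLeast.csInf_eq ⟨⟨hk, hwin⟩, fun _ hj => not_lt.mp fun hjk => hmin _ hj.1 hjk hj.2⟩

end Game

section Cycle

/-- The distance from `0` to the residue of `z` on the cycle of length `m`. -/
def arcLength (m : ℕ) (z : ℤ) : ℕ := (z : ZMod m).valMinAbs.natAbs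

section ArcLength

variable {m : ℕ} {z w : ℤ}

lemma arcLength_neg (m : ℕ) (z : ℤ) : arcLength m (-z) = arcLength m z := by
  rw [arcLength, arcLength, Int.cast_neg, ZMod.natAbs_valMinAbs_neg]

lemma arcLength_sub_comm (m : ℕ) (z w : ℤ) : arcLength m (z - w) = arcLength m (w - z) := by
  rw [← neg_sub, arcLength_neg]

lemma arcLength_eq_iff : arcLength m z = arcLength m w ↔ (m : ℤ) ∣ z - w ∨ (m : ℤ) ∣ z + w := by
  rw [arcLength, arcLength, ZMod.natAbs_valMinAbs_eq_natAbs_valMinAbs,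
    ← ZMod.intCast_zmod_eq_zero_iff_dvd, ← ZMod.intCast_zmod_eq_zero_iff_dvd, Int.cast_sub,
    Int.cast_add, sub_eq_zero, add_eq_zero_iff_eq_neg]

lemma arcLength_congr (h : (m : ℤ) ∣ z - w) : arcLength m z = arcLength m w :=
  arcLength_eq_iff.mpr (.inl h)

lemma exists_dvd_sub_and_natAbs_eq (m : ℕ) (z : ℤ) :
    ∃ r : ℤ, (m : ℤ) ∣ z - r ∧ r.natAbs = arcLength m z :=
  ⟨(z : ZMod m).valMinAbs, by rw [← ZMod.intCast_zmod_eq_zero_iff_dvd]; simp, rfl⟩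

lemma two_mul_arcLength_le (m : ℕ) [NeZero m] (z : ℤ) : 2 * arcLength m z ≤ m := by
  have := (z : ZMod m).natAbs_valMinAbs_le
  rw [arcLength]
  omega

lemma arcLength_eq_natAbs [NeZero m] (h : 2 * z.natAbs ≤ m) : arcLength m z = z.natAbs := by
  wlog hz : 0 ≤ z generalizing z
  · rw [← arcLength_neg, this (by omega) (by omega), Int.natAbs_neg]
  have hm := Nat.pos_of_ne_zero (NeZero.ne m)
  rw [arcLength, (ZMod.valMinAbs_spec _ z).mpr ⟨rfl, by constructor <;> omega⟩]

lemma arcLength_le_natAbs (m : ℕ) [NeZero m] (z : ℤ) : arcLength m z ≤ z.natAbs :=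
  ZMod.natAbs_min_of_le_div_two m _ _ (by simp) (ZMod.natAbs_valMinAbs_le _)

lemma arcLength_add_le (m : ℕ) [NeZero m] (z w : ℤ) :
    arcLength m (z + w) ≤ arcLength m z + w.natAbs := by
  obtain ⟨r, hr, hrz⟩ := exists_dvd_sub_and_natAbs_eq m z
  rw [arcLength_congr (w := r + w) (by rwa [add_sub_add_right_eq_sub]), ← hrz]
  exact (arcLength_le_natAbs m _).trans (Int.natAbs_add_le r w)

end ArcLength

variable {m : ℕ} [NeZero m]

/-- The residue of an integer as a vertex of the cycle of length `m`. -/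
def cycleVertex (m : ℕ) [NeZero m] (x : ℤ) : Fin m := (ZMod.finEquiv m).symm x

lemma cycleVertex_eq_iff {x y : ℤ} : cycleVertex m x = cycleVertex m y ↔ (m : ℤ) ∣ x - y := by
  rw [cycleVertex, cycleVertex, EquivLike.apply_eq_iff_eq, eq_comm,
    ZMod.intCast_eq_intCast_iff_dvd_sub]

lemma cycleVertex_val (v : Fin m) : cycleVertex m (v : ℤ) = v := by
  obtain ⟨l, rfl⟩ := Nat.exists_eq_succ_of_ne_zero (NeZero.ne m)
  refine (ZMod.finEquiv (l + 1)).symm_apply_eq.mpr ((Int.cast_natCast _).trans ?_)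
  exact ZMod.natCast_zmod_val (n := l + 1) v

lemma cycleVertex_sub_val_eq_one_iff (hm : 2 ≤ m) {x y : ℤ} :
    (cycleVertex m x - cycleVertex m y).val = 1 ↔ cycleVertex m x = cycleVertex m (y + 1) := by
  obtain ⟨l, rfl⟩ := Nat.exists_eq_add_of_le' hm
  change ((x : ZMod (l + 2)) - y).val = 1 ↔ (x : ZMod (l + 2)) = (y + 1 : ℤ)
  rw [ZMod.val_eq_one (by omega), sub_eq_iff_eq_add', Int.cast_add, Int.cast_one]

lemma cycleGraph_adj_cycleVertex_iff (hm : 2 ≤ m) {x : ℤ} {w : Fin m} :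
    (cycleGraph m).Adj (cycleVertex m x) w ↔
      w = cycleVertex m (x + 1) ∨ w = cycleVertex m (x - 1) := by
  rw [cycleGraph_adj', ← cycleVertex_val w, cycleVertex_sub_val_eq_one_iff hm,
    cycleVertex_sub_val_eq_one_iff hm, or_comm, @eq_comm _ (cycleVertex m x), cycleVertex_eq_iff,
    cycleVertex_eq_iff, cycleVertex_eq_iff, add_sub_right_comm, sub_sub_eq_add_sub,
    add_sub_right_comm]

lemma cycleGraph_connected_of_neZero : (cycleGraph m).Connected := by
  obtain ⟨l, rfl⟩ := Nat.exists_eq_succ_of_ne_zero (NeZero.ne m)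
  exact cycleGraph_connected

lemma cycleGraph_dist_add_le (hm : 2 ≤ m) (x : ℤ) (l : ℕ) :
    (cycleGraph m).dist (cycleVertex m x) (cycleVertex m (x + l)) ≤ l := by
  induction l with
  | zero => simp
  | succ l ih =>
    have hadj : (cycleGraph m).Adj (cycleVertex m (x + l)) (cycleVertex m (x + (l + 1 : ℕ))) :=
      (cycleGraph_adj_cycleVertex_iff hm).mpr (.inl (by push_cast; ring_nf))
    calc (cycleGraph m).dist (cycleVertex m x) (cycleVertex m (x + (l + 1 : ℕ)))
        ≤ _ := cycleGraph_connected_of_neZero.dist_triangle (v := cycleVertex m (x + l))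
      _ ≤ l + 1 := by rw [dist_eq_one_iff_adj.mpr hadj]; exact Nat.add_le_add_right ih 1

lemma arcLength_sub_le_walk_length (hm : 2 ≤ m) {u v : Fin m} (p : (cycleGraph m).Walk u v) :
    ∀ {x y : ℤ}, u = cycleVertex m x → v = cycleVertex m y → arcLength m (x - y) ≤ p.length := by
  induction p with
  | nil =>
    rintro x y rfl h
    rw [arcLength_congr (w := 0) (by simpa using cycleVertex_eq_iff.mp h)]
    exact arcLength_le_natAbs m 0
  | cons h p ih =>
    rintro x y rfl rfl
    rw [Walk.length_cons]
    rcases (cycleGraph_adj_cycleVertex_iff hm).mp h with h | h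
    · have := arcLength_add_le m (x + 1 - y) (-1)
      have := ih h rfl
      rw [show x + 1 - y + -1 = x - y by ring] at *
      omega
    · have := arcLength_add_le m (x - 1 - y) 1
      have := ih h rfl
      rw [show x - 1 - y + 1 = x - y by ring] at *
      omega

theorem cycleGraph_dist_cycleVertex (hm : 2 ≤ m) (x y : ℤ) :
    (cycleGraph m).dist (cycleVertex m x) (cycleVertex m y) = arcLength m (x - y) := by
  apply le_antisymm
  · obtain ⟨r, hr, hrz⟩ := exists_dvd_sub_and_natAbs_eq m (x - y)
    have hx : cycleVertex m x = cycleVertex m (y + r) :=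
      cycleVertex_eq_iff.mpr (by rwa [← sub_sub])
    rw [← hrz, hx]
    obtain h | h := Int.natAbs_eq r
    · rw [dist_comm]
      nth_rw 1 [h]
      exact cycleGraph_dist_add_le hm y _
    · have := cycleGraph_dist_add_le hm (y + r) r.natAbs
      rwa [show y + r + (r.natAbs : ℤ) = y by omega] at this
  · obtain ⟨p, hp⟩ := cycleGraph_connected_of_neZero.exists_walk_length_eq_dist
      (cycleVertex m x) (cycleVertex m y)
    exact hp ▸ arcLength_sub_le_walk_length hm p rfl rfl

end Cycle

section Torus

variable {m n : ℕ} [NeZero m] [NeZero n]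

/-- The toroidal grid `C_m □ C_n`. -/
abbrev torus (m n : ℕ) : SimpleGraph (Fin m × Fin n) := cycleGraph m □ cycleGraph n

/-- The vertex of the toroidal grid with given integral coordinates. -/
def torusVertex (m n : ℕ) [NeZero m] [NeZero n] (x y : ℤ) : Fin m × Fin n :=
  (cycleVertex m x, cycleVertex n y)

lemma torusVertex_eq_iff {x y x' y' : ℤ} : torusVertex m n x y = torusVertex m n x' y' ↔
    (m : ℤ) ∣ x - x' ∧ (n : ℤ) ∣ y - y' := by
  rw [torusVertex, torusVertex, Prod.mk.injEq, cycleVertex_eq_iff, cycleVertex_eq_iff]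

lemma exists_torusVertex_eq (v : Fin m × Fin n) : ∃ x y, torusVertex m n x y = v :=
  ⟨v.1, v.2, Prod.ext (cycleVertex_val _) (cycleVertex_val _)⟩

lemma torus_connected : (torus m n).Connected :=
  cycleGraph_connected_of_neZero.boxProd cycleGraph_connected_of_neZero

theorem torus_dist (hm : 2 ≤ m) (hn : 2 ≤ n) (x y a b : ℤ) :
    (torus m n).dist (torusVertex m n x y) (torusVertex m n a b) =
      arcLength m (x - a) + arcLength n (y - b) := by
  rw [← Nat.cast_inj (R := ℕ∞), (torus_connected _ _).coe_dist_eq_edist, edist_boxProd,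
    ← (cycleGraph_connected_of_neZero _ _).coe_dist_eq_edist,
    ← (cycleGraph_connected_of_neZero _ _).coe_dist_eq_edist, torusVertex, torusVertex,
    cycleGraph_dist_cycleVertex hm, cycleGraph_dist_cycleVertex hn, Nat.cast_add]

lemma torus_eq_or_adj_iff (hm : 2 ≤ m) (hn : 2 ≤ n) {x y : ℤ} {w : Fin m × Fin n} :
    (w = torusVertex m n x y ∨ (torus m n).Adj (torusVertex m n x y) w) ↔
      ∃ dx dy : ℤ, dx.natAbs + dy.natAbs ≤ 1 ∧ w = torusVertex m n (x + dx) (y + dy) := by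
  have hoffset : ∀ dx dy : ℤ, dx.natAbs + dy.natAbs ≤ 1 ↔ (dx = 0 ∧ dy = 0) ∨
      (dx = 1 ∧ dy = 0) ∨ (dx = -1 ∧ dy = 0) ∨ (dx = 0 ∧ dy = 1) ∨ (dx = 0 ∧ dy = -1) := by
    omega
  obtain ⟨w₁, w₂⟩ := w
  simp only [hoffset, boxProd_adj, torusVertex, cycleGraph_adj_cycleVertex_iff hm,
    cycleGraph_adj_cycleVertex_iff hn, or_and_right, exists_or, and_assoc,
    exists_and_left, exists_eq_left, Prod.mk.injEq, add_zero, ← sub_eq_add_neg]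
  tauto

theorem not_copWins_one_torus (hm : 3 ≤ m) (hn : 3 ≤ n) : ¬ (torus m n).CopWins 1 := by
  obtain ⟨a, rfl⟩ := Nat.exists_eq_add_of_le' hm
  obtain ⟨b, rfl⟩ := Nat.exists_eq_add_of_le' hn
  refine not_copWins_one_of_three_le_degree fun v => ?_
  rw [degree_boxProd, cycleGraph_degree_three_le, cycleGraph_degree_three_le]
  norm_num

end Torus

section ArcLengthSucc

variable {n : ℕ} {z w : ℤ}

lemma dvd_sub_of_arcLength_eq_of_arcLength_add_one_eq (hn : 3 ≤ n)
    (h₀ : arcLength n z = arcLength n w) (h₁ : arcLength n (z + 1) = arcLength n (w + 1)) :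
    (n : ℤ) ∣ z - w := by
  rcases arcLength_eq_iff.mp h₀, arcLength_eq_iff.mp h₁ with ⟨h₀ | h₀, h₁ | h₁⟩
  · exact h₀
  · exact h₀
  · simpa using h₁
  · have h₂ : (n : ℤ) ∣ 2 := by
      rw [show (2 : ℤ) = z + 1 + (w + 1) - (z + w) by ring]
      exact h₁.sub h₀
    have := Int.le_of_dvd two_pos h₂
    omega

lemma dvd_two_mul_add_one_of_arcLength_add_one_eq (hn : 2 ≤ n)
    (h : arcLength n (z + 1) = arcLength n z) : (n : ℤ) ∣ 2 * z + 1 := by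
  rcases arcLength_eq_iff.mp h with h | h
  · have := Int.le_of_dvd one_pos (by simpa using h)
    omega
  · rwa [show 2 * z + 1 = z + 1 + z by ring]

lemma arcLength_le_of_arcLength_add_one_eq [NeZero n] (hn : 2 ≤ n)
    (h : arcLength n (z + 1) = arcLength n z) (w : ℤ) : arcLength n w ≤ arcLength n z := by
  obtain ⟨r, hr, hrz⟩ := exists_dvd_sub_and_natAbs_eq n z
  have hdvd : (n : ℤ) ∣ 2 * r + 1 := by
    rw [show 2 * r + 1 = 2 * z + 1 - 2 * (z - r) by ring]
    exact (dvd_two_mul_add_one_of_arcLength_add_one_eq hn h).sub (hr.mul_left 2)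
  have hle := Nat.le_of_dvd (by omega) (Int.natCast_dvd.mp hdvd)
  have := two_mul_arcLength_le n w
  omega

lemma natAbs_arcLength_add_sub_le (n : ℕ) [NeZero n] (z d : ℤ) :
    ((arcLength n (z + d) : ℤ) - arcLength n z).natAbs ≤ d.natAbs := by
  have h₁ := arcLength_add_le n z d
  have h₂ := arcLength_add_le n (z + d) (-d)
  rw [add_neg_cancel_right] at h₂
  omega

lemma dvd_two_mul_add_one_of_arcLength_eq_add_one [NeZero n] (hn : 2 ≤ n)
    (h₀ : arcLength n z = arcLength n w) (h₁ : arcLength n (w + 1) = arcLength n (z + 1) + 1) :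
    (n : ℤ) ∣ 2 * w + 1 := by
  rcases arcLength_eq_iff.mp h₀ with h | h
  · rw [arcLength_congr (z := z + 1) (w := w + 1) (by simpa using h)] at h₁
    omega
  have hz : arcLength n (w - 1) = arcLength n (z + 1) :=
    arcLength_eq_iff.mpr (.inr (by rwa [show w - 1 + (z + 1) = z + w by ring]))
  have hstep₁ := natAbs_arcLength_add_sub_le n (w - 1) 1
  have hstep₂ := natAbs_arcLength_add_sub_le n w 1
  have hmax := arcLength_le_of_arcLength_add_one_eq (z := w - 1) hn (w := w + 1)
  rw [sub_add_cancel] at hstep₁ hmax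
  exact dvd_two_mul_add_one_of_arcLength_add_one_eq hn (by omega)

lemma dvd_two_mul_sub_one_of_arcLength_eq_add_one [NeZero n] (hn : 2 ≤ n)
    (h : (arcLength n w = arcLength n z + 1 ∧ arcLength n (w - 1) = arcLength n (z - 1)) ∨
      (arcLength n w = arcLength n z ∧ arcLength n (w - 1) = arcLength n (z - 1) + 1)) :
    (n : ℤ) ∣ 2 * w - 1 := by
  rcases h with ⟨h₁, h₀⟩ | ⟨h₀, h₁⟩
  · rw [show 2 * w - 1 = 2 * (w - 1) + 1 by ring]
    exact dvd_two_mul_add_one_of_arcLength_eq_add_one hn (z := z - 1) h₀.symm (by simpa using h₁)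
  · rw [← dvd_neg, show -(2 * w - 1) = 2 * -w + 1 by ring]
    refine dvd_two_mul_add_one_of_arcLength_eq_add_one hn (z := -z) ?_ ?_
    · rw [arcLength_neg, arcLength_neg, h₀]
    · rwa [neg_add_eq_sub, neg_add_eq_sub, arcLength_sub_comm, arcLength_sub_comm n 1]

end ArcLengthSucc

section OddCycle

lemma exists_forall_not_dvd_sub {n : ℕ} (hn : 4 ≤ n) (c : ℤ) :
    ∃ r : ℤ, ∀ e ∈ ({c, 0, -c} : Set ℤ), ¬ (n : ℤ) ∣ e - r := by
  have hsmall : ∀ d : ℤ, d ≠ 0 → d.natAbs ≤ 3 → ¬ (n : ℤ) ∣ d := fun d hd₀ hd hdvd => by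
    have := Nat.le_of_dvd (by omega) (Int.natCast_dvd.mp hdvd)
    omega
  by_cases hc : (n : ℤ) ∣ c - 1 ∨ (n : ℤ) ∣ c + 1
  · refine ⟨2, ?_⟩
    rintro e (rfl | rfl | rfl) he
    · rcases hc with hc | hc
      · exact hsmall 1 (by simp) (by simp) (by simpa using hc.sub he)
      · exact hsmall 3 (by simp) (by simp) (by simpa using hc.sub he)
    · exact hsmall _ (by simp) (by simp) he
    · rcases hc with hc | hc
      · exact hsmall (-3) (by simp) (by simp) (by convert! hc.add he using 1; ring)
      · exact hsmall (-1) (by simp) (by simp) (by convert! hc.add he using 1; ring)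
  · push Not at hc
    refine ⟨1, ?_⟩
    rintro e (rfl | rfl | rfl) he
    · exact hc.1 he
    · exact hsmall _ (by simp) (by simp) he
    · exact hc.2 (by rwa [← dvd_neg, neg_add])

lemma exists_forall_not_dvd_two_mul_sub {n : ℕ} (hn : 4 ≤ n) (c : ℤ) : ∃ p : ℤ,
    ∀ y ∈ ({c, -c} : Set ℤ), ∀ y' ∈ ({c, -c} : Set ℤ), ¬ (n : ℤ) ∣ y + y' - (2 * p + 1) := by
  suffices h : ∃ p : ℤ, ∀ e ∈ ({c, 0, -c} : Set ℤ), ¬ (n : ℤ) ∣ 2 * e - (2 * p + 1) by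
    obtain ⟨p, hp⟩ := h
    refine ⟨p, fun y hy y' hy' => ?_⟩
    obtain ⟨e, he, hee⟩ : ∃ e ∈ ({c, 0, -c} : Set ℤ), y + y' = 2 * e := by
      rcases hy with hy | hy <;> rcases hy' with hy' | hy' <;> rw [hy, hy']
      · exact ⟨c, by simp, by ring⟩
      · exact ⟨0, by simp, by ring⟩
      · exact ⟨0, by simp, by ring⟩
      · exact ⟨-c, by simp, by ring⟩
    exact hee ▸ hp e he
  obtain ⟨k, hk | hk⟩ := n.even_or_odd'
  · refine ⟨0, fun e _ he => ?_⟩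
    have : (2 : ℤ) ∣ 2 * e - (2 * 0 + 1) := dvd_trans ⟨k, by omega⟩ he
    omega
  obtain ⟨r, hr⟩ := exists_forall_not_dvd_sub (n := n) (by omega) c
  refine ⟨k + r, fun e he hdvd => hr e he ?_⟩
  have hcop : IsCoprime (n : ℤ) 2 := ⟨1, -k, by omega⟩
  refine hcop.dvd_of_dvd_mul_left ?_
  rw [show 2 * (e - r) = 2 * e - (2 * (k + r) + 1) + n by omega]
  exact hdvd.add dvd_rfl

variable {m n h : ℕ} [NeZero m] [NeZero n]

lemma arcLength_add_half_of_odd (hm : m = 2 * h + 1) (hh : 1 ≤ h) {d : ℤ} (hd : d.natAbs ≤ 1) :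
    (arcLength m (d + h) : ℤ) = h - if d = -1 then 1 else 0 := by
  obtain rfl | rfl | rfl : d = -1 ∨ d = 0 ∨ d = 1 := by omega
  · rw [arcLength_eq_natAbs (by omega), if_pos rfl]
    omega
  · rw [arcLength_eq_natAbs (by omega)]
    simp
  · rw [arcLength_congr (w := -h) ⟨1, by omega⟩, arcLength_eq_natAbs (by omega)]
    simp

lemma arcLength_sub_half_of_odd (hm : m = 2 * h + 1) (hh : 1 ≤ h) {d : ℤ} (hd : d.natAbs ≤ 1) :
    (arcLength m (d - h) : ℤ) = h - if d = 1 then 1 else 0 := by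
  rw [arcLength_sub_comm, sub_eq_neg_add, arcLength_add_half_of_odd hm hh (by omega)]
  simp only [neg_inj]

lemma dvd_sub_of_arcLength_sub_eq_of_odd (hm : m = 2 * h + 1) {x x' : ℤ}
    (he : (arcLength m x : ℤ) - arcLength m (x - h) = arcLength m x' - arcLength m (x' - h)) :
    (m : ℤ) ∣ x - x' := by
  have hdiff : ∀ x : ℤ, ∃ r : ℤ, (m : ℤ) ∣ x - r ∧ (arcLength m x : ℤ) - arcLength m (x - h) =
      if 0 ≤ r then 2 * r - h else -2 * r - 1 - h := by
    intro x
    obtain ⟨r, hr, hrx⟩ := exists_dvd_sub_and_natAbs_eq m x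
    have hle := two_mul_arcLength_le m x
    refine ⟨r, hr, ?_⟩
    rw [arcLength_congr (z := x - h) (w := r - h) (by simpa using hr)]
    split_ifs with h₀
    · rw [arcLength_eq_natAbs (z := r - h) (by omega)]
      omega
    · rw [arcLength_congr (z := r - h) (w := r + h + 1) ⟨-1, by omega⟩,
        arcLength_eq_natAbs (z := r + h + 1) (by omega)]
      omega
  obtain ⟨r, hr, hrx⟩ := hdiff x
  obtain ⟨r', hr', hrx'⟩ := hdiff x'
  have hrr' : r = r' := by
    rw [hrx, hrx'] at he
    split_ifs at he <;> omega
  rw [show x - x' = (x - r) - (x' - r') by rw [hrr']; ring]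
  exact hr.sub hr'

lemma eq_and_dvd_sub_of_half_probes_eq (hm : m = 2 * h + 1) (hh : 1 ≤ h) (hn : 3 ≤ n)
    {d d' δ δ' : ℤ} (hd : d.natAbs ≤ 1) (hd' : d'.natAbs ≤ 1)
    (hself : d ≠ 0 → ¬ (n : ℤ) ∣ 2 * δ - 1) (hself' : d' ≠ 0 → ¬ (n : ℤ) ∣ 2 * δ' - 1)
    (hsum : d ≠ 0 → d' ≠ 0 → ¬ (n : ℤ) ∣ δ + δ' - 1)
    (he₀ : arcLength m (d - h) + arcLength n δ = arcLength m (d' - h) + arcLength n δ')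
    (he₁ : arcLength m (d + h) + arcLength n (δ - 1) =
      arcLength m (d' + h) + arcLength n (δ' - 1)) :
    d = d' ∧ (n : ℤ) ∣ δ - δ' := by
  have h₁ := arcLength_sub_half_of_odd hm hh hd
  have h₁' := arcLength_sub_half_of_odd hm hh hd'
  have h₂ := arcLength_add_half_of_odd hm hh hd
  have h₂' := arcLength_add_half_of_odd hm hh hd'
  have hdd' : d = d' := by
    by_contra hne
    by_cases hd₀ : d = 0
    · refine hself' (by omega) ?_
      exact dvd_two_mul_sub_one_of_arcLength_eq_add_one (by omega) (z := δ) (by omega)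
    by_cases hd₀' : d' = 0
    · exact hself hd₀ (dvd_two_mul_sub_one_of_arcLength_eq_add_one (by omega) (z := δ') (by omega))
    have hδ := natAbs_arcLength_add_sub_le n (δ - 1) 1
    have hδ' := natAbs_arcLength_add_sub_le n (δ' - 1) 1
    rw [sub_add_cancel] at hδ hδ'
    refine hsum hd₀ hd₀' ?_
    rw [show δ + δ' - 1 = δ - 1 - -δ' by ring]
    apply dvd_sub_of_arcLength_eq_of_arcLength_add_one_eq hn
    · rw [arcLength_neg]
      omega
    · rw [sub_add_cancel, neg_add_eq_sub, arcLength_sub_comm n 1]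
      omega
  refine ⟨hdd', ?_⟩
  subst hdd'
  have hδ : (n : ℤ) ∣ δ - 1 - (δ' - 1) :=
    dvd_sub_of_arcLength_eq_of_arcLength_add_one_eq hn (by omega) (by simpa using he₀)
  simpa using hδ

/-- A robber next to column `x` cannot have moved sideways and vertically at once, so the two
probes, antipodal to column `x` from either side, separate sideways moves from vertical ones as
soon as no two members of `Y` are exchanged by the reflection `y ↦ 2 * p + 1 - y`. -/
lemma copWinsFrom_closedNeighborSet_column (hm : m = 2 * h + 1) (hh : 1 ≤ h) (hn : 3 ≤ n) (x p : ℤ)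
    {Y : Set ℤ} (hY : ∀ y ∈ Y, ∀ y' ∈ Y, ¬ (n : ℤ) ∣ y + y' - (2 * p + 1)) :
    CopWinsFrom (torus m n) 2 (closedNeighborSet (torus m n) (torusVertex m n x '' Y)) := by
  have hm2 : 2 ≤ m := by omega
  have hn2 : 2 ≤ n := by omega
  refine copWinsFrom_of_injOn ![torusVertex m n (x + h) p, torusVertex m n (x - h) (p + 1)] ?_
  have hmem : ∀ v ∈ closedNeighborSet (torus m n) (torusVertex m n x '' Y), ∃ d δ : ℤ,
      d.natAbs ≤ 1 ∧ (d ≠ 0 → δ + p ∈ Y) ∧ v = torusVertex m n (x + d) (δ + p) := by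
    intro v hv
    obtain ⟨v, ⟨y, hy, rfl⟩, hv⟩ := hv
    obtain ⟨d, dy, hd, rfl⟩ := (torus_eq_or_adj_iff hm2 hn2).mp hv
    refine ⟨d, y + dy - p, by omega, fun h => ?_, by rw [sub_add_cancel]⟩
    rwa [show dy = 0 by omega, add_zero, sub_add_cancel]
  intro v hv v' hv' he
  obtain ⟨d, δ, hd, hdY, rfl⟩ := hmem v hv
  obtain ⟨d', δ', hd', hdY', rfl⟩ := hmem v' hv'
  have he₀ := congrFun he 0
  have he₁ := congrFun he 1
  have hsub : ∀ d : ℤ, x + d - (x + h) = d - h ∧ x + d - (x - h) = d + h := by omega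
  have hsub' : ∀ δ : ℤ, δ + p - p = δ ∧ δ + p - (p + 1) = δ - 1 := by omega
  simp only [Matrix.cons_val_zero, Matrix.cons_val_one, torus_dist hm2 hn2, hsub, hsub'] at he₀ he₁
  obtain ⟨hdd', hδ⟩ := eq_and_dvd_sub_of_half_probes_eq hm hh hn hd hd'
    (fun hd₀ => by convert! hY _ (hdY hd₀) _ (hdY hd₀) using 2; ring)
    (fun hd₀' => by convert! hY _ (hdY' hd₀') _ (hdY' hd₀') using 2; ring)
    (fun hd₀ hd₀' => by convert! hY _ (hdY hd₀) _ (hdY' hd₀') using 2; ring) he₀ he₁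
  exact torusVertex_eq_iff.mpr ⟨by simp [hdd'], by simpa using hδ⟩

theorem copWins_two_torus_of_odd (hm : Odd m) (hm3 : 3 ≤ m) (hn : 4 ≤ n) :
    (torus m n).CopWins 2 := by
  obtain ⟨h, hm⟩ := hm
  refine copWins_of_probe ![torusVertex m n 0 0, torusVertex m n h 0] fun v => ?_
  obtain ⟨x, y, rfl⟩ := exists_torusVertex_eq v
  obtain ⟨p, hp⟩ := exists_forall_not_dvd_two_mul_sub hn y
  refine (copWinsFrom_closedNeighborSet_column hm (by omega) (by omega) x p hp).mono
    (closedNeighborSet_mono fun v' he => ?_)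
  obtain ⟨x', y', rfl⟩ := exists_torusVertex_eq v'
  simp only [Fin.forall_fin_two, Matrix.cons_val_zero, Matrix.cons_val_one,
    torus_dist (m := m) (n := n) (by omega) (by omega), sub_zero, Set.mem_ofPred_eq] at he
  obtain ⟨he₀, he₁⟩ := he
  have hx : (m : ℤ) ∣ x' - x := dvd_sub_of_arcLength_sub_eq_of_odd hm (by omega)
  have hy : arcLength n y' = arcLength n y := by
    have := arcLength_congr hx
    omega
  rcases arcLength_eq_iff.mp hy with hy | hy
  · exact ⟨y, by simp, torusVertex_eq_iff.mpr ⟨dvd_sub_comm.mp hx, dvd_sub_comm.mp hy⟩⟩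
  · exact ⟨-y, by simp,
      torusVertex_eq_iff.mpr ⟨dvd_sub_comm.mp hx, dvd_sub_comm.mp (by simpa using hy)⟩⟩

end OddCycle

section EvenCycle

variable {m n h : ℕ} [NeZero m] [NeZero n]

lemma arcLength_sub_half_of_even (hm : m = 2 * h) (z : ℤ) :
    arcLength m (z - h) + arcLength m z = h := by
  obtain ⟨r, hr, hrz⟩ := exists_dvd_sub_and_natAbs_eq m z
  have hle := two_mul_arcLength_le m z
  rw [arcLength_congr (z := z - h) (w := r - h) (by simpa using hr)]
  rcases le_or_gt 0 r with h₀ | h₀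
  · rw [arcLength_eq_natAbs (z := r - h) (by omega)]
    omega
  · rw [arcLength_congr (z := r - h) (w := r + h) ⟨-1, by omega⟩,
      arcLength_eq_natAbs (z := r + h) (by omega)]
    omega

lemma arcLength_add_one_of_even (hm : m = 2 * h) (z : ℤ) :
    arcLength m (z + 1) = arcLength m z + 1 ∨ arcLength m z = arcLength m (z + 1) + 1 := by
  have hle := natAbs_arcLength_add_sub_le m z 1
  have hne : arcLength m (z + 1) ≠ arcLength m z := fun he => by
    have h₂ : (2 : ℤ) ∣ 2 * z + 1 := by
      have := NeZero.ne m
      exact dvd_trans ⟨h, by omega⟩ (dvd_two_mul_add_one_of_arcLength_add_one_eq (by omega) he)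
    omega
  omega

lemma arcLength_eq_zero_or_half_of_even (hm : m = 2 * h) (hh : 2 ≤ h) {z : ℤ}
    (he : arcLength m (z + 1) = arcLength m (z - 1)) : arcLength m z = 0 ∨ arcLength m z = h := by
  rcases arcLength_eq_iff.mp he with h₂ | ⟨c, hc⟩
  · have := Int.le_of_dvd two_pos (by convert! h₂ using 1; ring)
    omega
  have hz : z = h * c := by
    have : (m : ℤ) * c = 2 * (h * c) := by rw [hm]; push_cast; ring
    omega
  have h₀ : arcLength m 0 = 0 := arcLength_eq_natAbs (by simp)
  obtain ⟨l, rfl | rfl⟩ := c.even_or_odd'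
  · left
    rw [arcLength_congr (w := 0) ⟨l, by rw [hz, hm]; push_cast; ring⟩, h₀]
  · right
    have := arcLength_sub_half_of_even hm z
    rw [arcLength_congr (z := z - h) (w := 0) ⟨l, by rw [hz, hm]; push_cast; ring⟩, h₀] at this
    omega

lemma arcLength_eq_of_antipodal_probes_eq (hm : m = 2 * h) (hm2 : 2 ≤ m) (hn2 : 2 ≤ n)
    {x y x' y' a b : ℤ}
    (h₀ : (torus m n).dist (torusVertex m n x y) (torusVertex m n a b) =
      (torus m n).dist (torusVertex m n x' y') (torusVertex m n a b))
    (h₁ : (torus m n).dist (torusVertex m n x y) (torusVertex m n (a + h) b) =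
      (torus m n).dist (torusVertex m n x' y') (torusVertex m n (a + h) b)) :
    arcLength m (x - a) = arcLength m (x' - a) ∧ arcLength n (y - b) = arcLength n (y' - b) := by
  simp only [torus_dist hm2 hn2, ← sub_sub] at h₀ h₁
  have hx := arcLength_sub_half_of_even hm (x - a)
  have hx' := arcLength_sub_half_of_even hm (x' - a)
  omega

lemma copWinsFrom_closedNeighborSet_range_torusVertex (hm : Even m) (hm4 : 4 ≤ m) (hn : 3 ≤ n)
    (x : ℤ) :
    CopWinsFrom (torus m n) 3 (closedNeighborSet (torus m n) (Set.range (torusVertex m n x))) := by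
  obtain ⟨h, hm⟩ := even_iff_exists_two_mul.mp hm
  have hm2 : 2 ≤ m := by omega
  have hn2 : 2 ≤ n := by omega
  refine copWinsFrom_of_injOn
    ![torusVertex m n (x - 1) 1, torusVertex m n (x - 1 + h) 1, torusVertex m n x 0] ?_
  have hmem : ∀ v ∈ closedNeighborSet (torus m n) (Set.range (torusVertex m n x)), ∃ d y : ℤ,
      d.natAbs ≤ 1 ∧ v = torusVertex m n (x + d) y := by
    rintro v ⟨v, ⟨y, rfl⟩, hv⟩
    obtain ⟨d, dy, hd, rfl⟩ := (torus_eq_or_adj_iff hm2 hn2).mp hv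
    exact ⟨d, y + dy, by omega, rfl⟩
  intro v hv v' hv' he
  obtain ⟨d, y, hd, rfl⟩ := hmem v hv
  obtain ⟨d', y', hd', rfl⟩ := hmem v' hv'
  obtain ⟨hx, hy⟩ := arcLength_eq_of_antipodal_probes_eq hm hm2 hn2 (congrFun he 0) (congrFun he 1)
  rw [show x + d - (x - 1) = d + 1 by ring, show x + d' - (x - 1) = d' + 1 by ring,
    arcLength_eq_natAbs (by omega), arcLength_eq_natAbs (by omega)] at hx
  obtain rfl : d = d' := by omega
  have hy₀ := congrFun he 2
  simp only [Matrix.cons_val, torus_dist hm2 hn2, sub_zero, Nat.add_left_cancel_iff] at hy₀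
  have hyy' : (n : ℤ) ∣ y - 1 - (y' - 1) :=
    dvd_sub_of_arcLength_eq_of_arcLength_add_one_eq hn hy (by simpa using hy₀)
  exact torusVertex_eq_iff.mpr ⟨by simp, by simpa using hyy'⟩

theorem copWins_three_torus_of_even (hm : Even m) (hm4 : 4 ≤ m) (hn : 3 ≤ n) :
    (torus m n).CopWins 3 := by
  obtain ⟨h, hh⟩ := even_iff_exists_two_mul.mp hm
  have hm2 : 2 ≤ m := by omega
  have hn2 : 2 ≤ n := by omega
  refine copWins_of_probe
    ![torusVertex m n 0 0, torusVertex m n (0 + h) 0, torusVertex m n (-1) 0] fun v => ?_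
  obtain ⟨x, y, rfl⟩ := exists_torusVertex_eq v
  refine (copWinsFrom_closedNeighborSet_range_torusVertex hm hm4 hn x).mono
    (closedNeighborSet_mono fun v' he => ?_)
  obtain ⟨x', y', rfl⟩ := exists_torusVertex_eq v'
  obtain ⟨hx, hy⟩ := arcLength_eq_of_antipodal_probes_eq hh hm2 hn2 (he 0) (he 1)
  have hx₁ := he 2
  simp only [Matrix.cons_val, torus_dist hm2 hn2, hy, Nat.add_right_cancel_iff,
    sub_neg_eq_add] at hx₁
  have hxx' : (m : ℤ) ∣ x' - x :=
    dvd_sub_of_arcLength_eq_of_arcLength_add_one_eq (by omega) (by simpa using hx) hx₁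
  exact ⟨y', torusVertex_eq_iff.mpr ⟨dvd_sub_comm.mp hxx', by simp⟩⟩

lemma dvd_sub_or_two_le_or_dvd_sub_add_one (hm : Even m) (hm6 : 6 ≤ m) {x x' : ℤ}
    (hsum : ((arcLength m x + arcLength m (x + 1) : ℤ) -
      (arcLength m x' + arcLength m (x' + 1))).natAbs ≤ 2) :
    (m : ℤ) ∣ x' - x ∨ 2 ≤ ((arcLength m (x - 1) : ℤ) - arcLength m (x' - 1)).natAbs ∨
      ((arcLength m (x - 1) : ℤ) - arcLength m (x' - 1)).natAbs = 1 ∧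
        ((m : ℤ) ∣ x' - (x + 1) ∨ (m : ℤ) ∣ x - (x' + 1)) := by
  obtain ⟨h, hm⟩ := even_iff_exists_two_mul.mp hm
  have hprofile : ∀ z : ℤ,
      (arcLength m (z + 1) = arcLength m z + 1 ∨ arcLength m z = arcLength m (z + 1) + 1) ∧
      (arcLength m z = arcLength m (z - 1) + 1 ∨ arcLength m (z - 1) = arcLength m z + 1) ∧
      (arcLength m (z + 1) = arcLength m (z - 1) → arcLength m z = 0 ∨ arcLength m z = h) ∧
      arcLength m (z + 1) ≤ h ∧ arcLength m z ≤ h ∧ arcLength m (z - 1) ≤ h := fun z =>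
    ⟨arcLength_add_one_of_even hm z, by simpa using arcLength_add_one_of_even hm (z - 1),
      arcLength_eq_zero_or_half_of_even hm (by omega),
      by have := two_mul_arcLength_le m (z + 1); omega,
      by have := two_mul_arcLength_le m z; omega,
      by have := two_mul_arcLength_le m (z - 1); omega⟩
  have hfact : ∀ {z w : ℤ}, arcLength m z = arcLength m w →
      arcLength m (z + 1) = arcLength m (w + 1) → (m : ℤ) ∣ z - w :=
    dvd_sub_of_arcLength_eq_of_arcLength_add_one_eq (by omega)
  have hcases : (arcLength m x' = arcLength m x ∧ arcLength m (x' + 1) = arcLength m (x + 1)) ∨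
      2 ≤ ((arcLength m (x - 1) : ℤ) - arcLength m (x' - 1)).natAbs ∨
      ((arcLength m (x - 1) : ℤ) - arcLength m (x' - 1)).natAbs = 1 ∧
        ((arcLength m (x' - 1) = arcLength m x ∧ arcLength m x' = arcLength m (x + 1)) ∨
          (arcLength m (x - 1) = arcLength m x' ∧ arcLength m x = arcLength m (x' + 1))) := by
    have hx := hprofile x
    have hx' := hprofile x'
    omega
  rcases hcases with ⟨h₀, h₁⟩ | hw | ⟨hw, ⟨h₀, h₁⟩ | ⟨h₀, h₁⟩⟩
  · exact .inl (hfact h₀ h₁)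
  · exact .inr (.inl hw)
  · refine .inr (.inr ⟨hw, .inl ?_⟩)
    rw [show x' - (x + 1) = x' - 1 - x by ring]
    exact hfact h₀ (by simpa using h₁)
  · refine .inr (.inr ⟨hw, .inr ?_⟩)
    rw [show x - (x' + 1) = x - 1 - x' by ring]
    exact hfact h₀ (by simpa using h₁)

end EvenCycle

section EvenTorus

variable {m n : ℕ}

/-- The vertices of the toroidal grid with coordinates `(x, y)` and `(x', y')` are opposite corners
of a face. -/
def IsDiagonal (m n : ℕ) (x y x' y' : ℤ) : Prop :=
  ((m : ℤ) ∣ x' - (x + 1) ∨ (m : ℤ) ∣ x - (x' + 1)) ∧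
    ((n : ℤ) ∣ y' - (y + 1) ∨ (n : ℤ) ∣ y - (y' + 1))

lemma IsDiagonal.not_two_dvd_sub (hm : Even m) {x y x' y' : ℤ} (h : IsDiagonal m n x y x' y') :
    ¬ (2 : ℤ) ∣ x' - x := by
  have h2m : (2 : ℤ) ∣ m := by exact_mod_cast hm.two_dvd
  rcases h.1 with h | h
  · have := h2m.trans h
    omega
  · have := h2m.trans h
    omega

lemma IsDiagonal.symm {x y x' y' : ℤ} (h : IsDiagonal m n x y x' y') : IsDiagonal m n x' y' x y :=
  ⟨h.1.symm, h.2.symm⟩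

variable [NeZero m] [NeZero n]

lemma IsDiagonal.exists_pair_eq {x y x' y' : ℤ} (h : IsDiagonal m n x y x' y') :
    ∃ x₀ y₀ ε : ℤ, (ε = 1 ∨ ε = -1) ∧ ({torusVertex m n x y, torusVertex m n x' y'} : Set _) =
      {torusVertex m n x₀ y₀, torusVertex m n (x₀ + 1) (y₀ + ε)} := by
  wlog hx : (m : ℤ) ∣ x' - (x + 1) generalizing x y x' y'
  · rw [Set.pair_comm]
    exact this h.symm (h.1.resolve_left hx)
  rcases h.2 with hy | hy
  · exact ⟨x, y, 1, .inl rfl, by rw [torusVertex_eq_iff.mpr ⟨hx, hy⟩]⟩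
  · refine ⟨x, y, -1, .inr rfl, ?_⟩
    rw [torusVertex_eq_iff.mpr ⟨hx, (dvd_sub_comm.mp hy).trans ?_⟩]
    exact ⟨1, by ring⟩

lemma subsingleton_or_subset_diagonal_of_pairwise (hm : Even m) {C : Set (Fin m × Fin n)}
    (hC : ∀ x y x' y', torusVertex m n x y ∈ C → torusVertex m n x' y' ∈ C →
      torusVertex m n x y = torusVertex m n x' y' ∨ IsDiagonal m n x y x' y') :
    C.Subsingleton ∨ ∃ x y ε : ℤ, (ε = 1 ∨ ε = -1) ∧
      C ⊆ {torusVertex m n x y, torusVertex m n (x + 1) (y + ε)} := by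
  refine or_iff_not_imp_left.mpr fun hne => ?_
  obtain ⟨v, hv, v', hv', hvv'⟩ := Set.not_subsingleton_iff.mp hne
  obtain ⟨x, y, rfl⟩ := exists_torusVertex_eq v
  obtain ⟨x', y', rfl⟩ := exists_torusVertex_eq v'
  have hd := (hC x y x' y' hv hv').resolve_left hvv'
  obtain ⟨x₀, y₀, ε, hε, hpair⟩ := hd.exists_pair_eq
  refine ⟨x₀, y₀, ε, hε, hpair ▸ fun v'' hv'' => ?_⟩
  obtain ⟨x'', y'', rfl⟩ := exists_torusVertex_eq v''
  rcases hC _ _ _ _ hv'' hv with h | hd₁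
  · exact .inl h
  rcases hC _ _ _ _ hv'' hv' with h | hd₂
  · exact .inr h
  have := hd.not_two_dvd_sub hm
  have := hd₁.not_two_dvd_sub hm
  have := hd₂.not_two_dvd_sub hm
  omega

lemma copWinsFrom_image2_torusVertex_Icc (hm : 2 ≤ m) (hn : 2 ≤ n) {x x' y y' : ℤ}
    (hx : 2 * (x' - x) ≤ m) (hyy' : y ≤ y') (hy : 2 * (y' - y) ≤ n) : CopWinsFrom (torus m n) 2
      (Set.image2 (torusVertex m n) (Set.Icc x x') (Set.Icc y y')) := by
  refine copWinsFrom_of_injOn ![torusVertex m n x y, torusVertex m n x y'] ?_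
  rintro _ ⟨i, ⟨hi, hi'⟩, j, ⟨hj, hj'⟩, rfl⟩ _ ⟨k, ⟨hk, hk'⟩, l, ⟨hl, hl'⟩, rfl⟩ he
  have he₀ := congrFun he 0
  have he₁ := congrFun he 1
  simp only [Matrix.cons_val_zero, Matrix.cons_val_one, torus_dist hm hn] at he₀ he₁
  rw [arcLength_eq_natAbs (by omega), arcLength_eq_natAbs (by omega),
    arcLength_eq_natAbs (by omega), arcLength_eq_natAbs (by omega)] at he₀ he₁
  obtain rfl : i = k := by omega
  obtain rfl : j = l := by omega
  rfl

lemma copWinsFrom_closedNeighborSet_diagonal (hm : 6 ≤ m) (hn : 6 ≤ n) (x y : ℤ) {ε : ℤ}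
    (hε : ε = 1 ∨ ε = -1) : CopWinsFrom (torus m n) 2
      (closedNeighborSet (torus m n) {torusVertex m n x y, torusVertex m n (x + 1) (y + ε)}) := by
  refine (copWinsFrom_image2_torusVertex_Icc (by omega) (by omega) (x := x - 1) (x' := x + 2)
    (y := min y (y + ε) - 1) (y' := max y (y + ε) + 1) (by omega) (by omega) (by omega)).mono ?_
  rintro w ⟨v, rfl | rfl, hw⟩ <;>
  · obtain ⟨dx, dy, hd, rfl⟩ := (torus_eq_or_adj_iff (by omega) (by omega)).mp hw
    exact ⟨_, ⟨by omega, by omega⟩, _, ⟨by omega, by omega⟩, rfl⟩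

lemma dvd_sub_or_isDiagonal_of_even (hm : Even m) (hn : Even n) (hm6 : 6 ≤ m) (hn6 : 6 ≤ n)
    {x y x' y' : ℤ}
    (hnear : ((arcLength m (x - 1) : ℤ) - arcLength m (x' - 1)).natAbs +
      ((arcLength n (y - 1) : ℤ) - arcLength n (y' - 1)).natAbs ≤ 2)
    (hsum : arcLength m (x + 1) + arcLength n (y + 1) =
      arcLength m (x' + 1) + arcLength n (y' + 1))
    (hdiff : (arcLength m x : ℤ) - arcLength n y = arcLength m x' - arcLength n y') :
    ((m : ℤ) ∣ x' - x ∧ (n : ℤ) ∣ y' - y) ∨ IsDiagonal m n x y x' y' := by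
  have hstepx := natAbs_arcLength_add_sub_le m x 1
  have hstepx' := natAbs_arcLength_add_sub_le m x' 1
  have hstepy := natAbs_arcLength_add_sub_le n y 1
  have hstepy' := natAbs_arcLength_add_sub_le n y' 1
  have hx := dvd_sub_or_two_le_or_dvd_sub_add_one hm hm6 (x := x) (x' := x') (by omega)
  have hy := dvd_sub_or_two_le_or_dvd_sub_add_one hn hn6 (x := y) (x' := y') (by omega)
  have hxy : (m : ℤ) ∣ x' - x → (n : ℤ) ∣ y' - y := fun h => by
    have h₀ := arcLength_congr h
    have h₁ : arcLength m (x' + 1) = arcLength m (x + 1) := arcLength_congr (by simpa using h)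
    exact dvd_sub_of_arcLength_eq_of_arcLength_add_one_eq (by omega) (by omega) (by omega)
  have hyx : (n : ℤ) ∣ y' - y → (m : ℤ) ∣ x' - x := fun h => by
    have h₀ := arcLength_congr h
    have h₁ : arcLength n (y' + 1) = arcLength n (y + 1) := arcLength_congr (by simpa using h)
    exact dvd_sub_of_arcLength_eq_of_arcLength_add_one_eq (by omega) (by omega) (by omega)
  rcases hx with hx | hx
  · exact .inl ⟨hx, hxy hx⟩
  rcases hy with hy | hy
  · exact .inl ⟨hyx hy, hy⟩
  rcases hx with hx | ⟨hx₁, hx⟩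
  · omega
  rcases hy with hy | ⟨-, hy⟩
  · omega
  exact .inr ⟨hx, hy⟩

lemma copWinsFrom_closedNeighborSet_arcLength (hm : Even m) (hn : Even n) (hm6 : 6 ≤ m)
    (hn6 : 6 ≤ n) (a b : ℕ) : CopWinsFrom (torus m n) 2 (closedNeighborSet (torus m n)
      {v | ∃ x y, arcLength m (x - 1) = a ∧ arcLength n (y - 1) = b ∧
        v = torusVertex m n x y}) := by
  obtain ⟨k, hk⟩ := even_iff_exists_two_mul.mp hn
  have hm2 : 2 ≤ m := by omega
  have hn2 : 2 ≤ n := by omega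
  set S : Set (Fin m × Fin n) := {v | ∃ x y, arcLength m (x - 1) = a ∧ arcLength n (y - 1) = b ∧
    v = torusVertex m n x y}
  have hS : ∀ x y, torusVertex m n x y ∈ closedNeighborSet (torus m n) S →
      ((arcLength m (x - 1) : ℤ) - a).natAbs + ((arcLength n (y - 1) : ℤ) - b).natAbs ≤ 1 := by
    rintro x y ⟨_, ⟨x', y', rfl, rfl, rfl⟩, hv⟩
    obtain ⟨dx, dy, hd, hv⟩ := (torus_eq_or_adj_iff hm2 hn2).mp hv
    obtain ⟨hx, hy⟩ := torusVertex_eq_iff.mp hv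
    rw [arcLength_congr (z := x - 1) (w := x' - 1 + dx) (by convert! hx using 1; ring),
      arcLength_congr (z := y - 1) (w := y' - 1 + dy) (by convert! hy using 1; ring)]
    have := natAbs_arcLength_add_sub_le m (x' - 1) dx
    have := natAbs_arcLength_add_sub_le n (y' - 1) dy
    omega
  refine copWinsFrom_of_probe ![torusVertex m n (-1) (-1), torusVertex m n 0 k] fun c => ?_
  refine (subsingleton_or_subset_diagonal_of_pairwise (n := n) hm
    fun x y x' y' hv hv' => ?_).imp_right ?_
  · have he := fun i => (hv.2 i).trans (hv'.2 i).symm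
    simp only [Fin.forall_fin_two, Matrix.cons_val_zero, Matrix.cons_val_one, torus_dist hm2 hn2,
      sub_neg_eq_add, sub_zero] at he
    have := hS x y hv.1
    have := hS x' y' hv'.1
    have := arcLength_sub_half_of_even hk y
    have := arcLength_sub_half_of_even hk y'
    refine (dvd_sub_or_isDiagonal_of_even hm hn hm6 hn6 (by omega) he.1 (by omega)).imp_left ?_
    exact fun h => torusVertex_eq_iff.mpr ⟨dvd_sub_comm.mp h.1, dvd_sub_comm.mp h.2⟩
  · rintro ⟨x, y, ε, hε, hsub⟩
    exact (copWinsFrom_closedNeighborSet_diagonal hm6 hn6 x y hε).mono (closedNeighborSet_mono hsub)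

theorem copWins_two_torus_of_even (hm : Even m) (hn : Even n) (hm6 : 6 ≤ m) (hn6 : 6 ≤ n) :
    (torus m n).CopWins 2 := by
  obtain ⟨h, hh⟩ := even_iff_exists_two_mul.mp hm
  refine copWins_of_probe ![torusVertex m n 1 1, torusVertex m n (1 + h) 1] fun v => ?_
  obtain ⟨x, y, rfl⟩ := exists_torusVertex_eq v
  refine (copWinsFrom_closedNeighborSet_arcLength hm hn hm6 hn6 (arcLength m (x - 1))
    (arcLength n (y - 1))).mono (closedNeighborSet_mono fun v' he => ?_)
  obtain ⟨x', y', rfl⟩ := exists_torusVertex_eq v'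
  obtain ⟨hx, hy⟩ :=
    arcLength_eq_of_antipodal_probes_eq hh (by omega) (by omega) (he 0) (he 1)
  exact ⟨x', y', hx, hy, rfl⟩

end EvenTorus

section HeightFour

variable {m : ℕ} [NeZero m]

lemma arcLength_four_of_dvd {z : ℤ} (h : 4 ∣ z) : arcLength 4 z = 0 :=
  (arcLength_congr (w := 0) (by simpa using h)).trans (arcLength_eq_natAbs (by simp))

lemma arcLength_four_of_dvd_sub_two {z : ℤ} (h : 4 ∣ z - 2) : arcLength 4 z = 2 :=
  (arcLength_congr (w := 2) (by simpa using h)).trans (arcLength_eq_natAbs (by simp))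

lemma arcLength_four_of_odd {z : ℤ} (h : Odd z) : arcLength 4 z = 1 := by
  obtain ⟨k, rfl⟩ := h
  have h₁ : arcLength 4 1 = 1 := arcLength_eq_natAbs (by simp)
  rw [← h₁, arcLength_eq_iff]
  omega

/-- The vertex at height `z` of the tetrahedron formed by the vertices of the first two columns of
`C_m □ C_4` whose coordinate sum has the parity of `s`. Its vertices are pairwise at distance `2`
when `m ≥ 3`. -/
def tetrahedronVertex (m : ℕ) [NeZero m] (s z : ℤ) : Fin m × Fin 4 :=
  torusVertex m 4 ((z + s) % 2) z

lemma tetrahedronVertex_congr {s z z' : ℤ} (h : 4 ∣ z - z') :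
    tetrahedronVertex m s z = tetrahedronVertex m s z' := by
  rw [tetrahedronVertex, tetrahedronVertex, show (z + s) % 2 = (z' + s) % 2 by omega]
  exact torusVertex_eq_iff.mpr ⟨by simp, h⟩

lemma tetrahedronVertex_eq_or_adj (hm : 2 ≤ m) {s z z' : ℤ} (h : ¬ 4 ∣ z' - (z + 2)) :
    tetrahedronVertex m (s + 1) z' = tetrahedronVertex m s z ∨
      (torus m 4).Adj (tetrahedronVertex m s z) (tetrahedronVertex m (s + 1) z') := by
  obtain ⟨d, hd, hdvd⟩ : ∃ d : ℤ, d.natAbs ≤ 1 ∧ 4 ∣ z' - (z + d) := by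
    by_cases h₀ : 4 ∣ z' - z
    · exact ⟨0, by simp, by simpa using h₀⟩
    by_cases h₁ : 4 ∣ z' - (z + 1)
    · exact ⟨1, by simp, h₁⟩
    · exact ⟨-1, by simp, by omega⟩
  rw [tetrahedronVertex_congr hdvd]
  refine (torus_eq_or_adj_iff hm (by simp)).mpr
    ⟨(z + d + (s + 1)) % 2 - (z + s) % 2, d, by omega, ?_⟩
  rw [tetrahedronVertex, add_sub_cancel]

lemma exists_forall_dist_tetrahedronVertex_eq (hm : Even m) (s : ℤ) (p : Fin m × Fin 4) :
    ∃ (c : ℤ) (e : ℕ), ∀ z, ¬ 4 ∣ z - c → (torus m 4).dist (tetrahedronVertex m s z) p = e := by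
  obtain ⟨h, hm⟩ := even_iff_exists_two_mul.mp hm
  have hm2 : 2 ≤ m := by
    have := NeZero.ne m
    omega
  obtain ⟨a, b, rfl⟩ := exists_torusVertex_eq p
  set X : ℤ → ℕ := fun z => arcLength m ((z + s) % 2 - a) with hX
  have hXX : X (b + 1) = X b + 1 ∨ X b = X (b + 1) + 1 := by
    rcases Int.emod_two_eq_zero_or_one (b + s) with hb | hb
    · have := arcLength_add_one_of_even hm (-a)
      simp only [hX, hb, show (b + 1 + s) % 2 = 1 by omega, sub_eq_neg_add, add_zero]
      exact this
    · have := arcLength_add_one_of_even hm (-a)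
      simp only [hX, hb, show (b + 1 + s) % 2 = 0 by omega, sub_eq_neg_add, add_zero]
      exact this.symm
  have hdist : ∀ z, (torus m 4).dist (tetrahedronVertex m s z) (torusVertex m 4 a b) =
      X z + arcLength 4 (z - b) := fun z => torus_dist hm2 (by simp) _ _ _ _
  have hodd : ∀ z, Odd (z - b) → (torus m 4).dist (tetrahedronVertex m s z) (torusVertex m 4 a b) =
      X (b + 1) + 1 := fun z hz => by
    have hXz : X z = X (b + 1) := by
      simp only [hX, show (z + s) % 2 = (b + 1 + s) % 2 by rw [Int.odd_iff] at hz; omega]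
    rw [hdist, arcLength_four_of_odd hz, hXz]
  have heven : ∀ z, 2 ∣ z - b → X z = X b := fun z hz => by
    simp only [hX, show (z + s) % 2 = (b + s) % 2 by omega]
  rcases hXX with hXX | hXX
  · refine ⟨b, X b + 2, fun z hz => ?_⟩
    rcases Int.even_or_odd (z - b) with hzb | hzb
    · rw [hdist, heven z hzb.two_dvd, arcLength_four_of_dvd_sub_two]
      have := hzb.two_dvd
      omega
    · rw [hodd z hzb, hXX]
  · refine ⟨b + 2, X b, fun z hz => ?_⟩
    rcases Int.even_or_odd (z - b) with hzb | hzb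
    · rw [hdist, heven z hzb.two_dvd, arcLength_four_of_dvd, add_zero]
      have := hzb.two_dvd
      omega
    · rw [hodd z hzb, hXX]

theorem not_copWins_two_torus_four (hm : Even m) : ¬ (torus m 4).CopWins 2 := by
  have hm2 : 2 ≤ m := by
    have := NeZero.ne m
    have := hm.two_dvd
    omega
  have hpair : ∀ s z z', ¬ 4 ∣ z - z' →
      ({tetrahedronVertex m s z, tetrahedronVertex m s z'} : Set _).Nontrivial := fun s z z' h =>
    Set.nontrivial_pair fun he => h (torusVertex_eq_iff.mp he).2
  have hevasive : IsEvasive (torus m 4) 2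
      {S | S.Nontrivial ∧ ∃ s, S ⊆ Set.range (tetrahedronVertex m s)} := by
    rintro S ⟨hS, s, hSs⟩ p
    obtain ⟨c₀, e₀, hc₀⟩ := exists_forall_dist_tetrahedronVertex_eq hm (s + 1) (p 0)
    obtain ⟨c₁, e₁, hc₁⟩ := exists_forall_dist_tetrahedronVertex_eq hm (s + 1) (p 1)
    obtain ⟨z, z', hzz', hz₀, hz₁, hz₀', hz₁'⟩ : ∃ z z' : ℤ, ¬ 4 ∣ z - z' ∧ ¬ 4 ∣ z - c₀ ∧
        ¬ 4 ∣ z - c₁ ∧ ¬ 4 ∣ z' - c₀ ∧ ¬ 4 ∣ z' - c₁ := by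
      by_cases h₁ : 4 ∣ c₁ - (c₀ + 1)
      · exact ⟨c₀ + 2, c₀ + 3, by omega⟩
      by_cases h₂ : 4 ∣ c₁ - (c₀ + 2)
      · exact ⟨c₀ + 1, c₀ + 3, by omega⟩
      · exact ⟨c₀ + 1, c₀ + 2, by omega⟩
    refine ⟨_, ⟨hpair (s + 1) z z' hzz', s + 1, ?_⟩, fun v hv => ?_, ![e₀, e₁], ?_⟩
    · exact Set.pair_subset ⟨z, rfl⟩ ⟨z', rfl⟩
    · obtain ⟨v₁, hv₁, v₂, hv₂, hne⟩ := hS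
      obtain ⟨u₁, rfl⟩ := hSs hv₁
      obtain ⟨u₂, rfl⟩ := hSs hv₂
      obtain ⟨w, rfl⟩ : ∃ w, tetrahedronVertex m (s + 1) w = v :=
        hv.elim (fun h => ⟨z, h.symm⟩) fun h => ⟨z', h.symm⟩
      have hu : ¬ 4 ∣ u₁ - u₂ := fun h => hne (tetrahedronVertex_congr h)
      by_cases hw : 4 ∣ w - (u₁ + 2)
      · exact ⟨_, hv₂, tetrahedronVertex_eq_or_adj hm2 (by omega)⟩
      · exact ⟨_, hv₁, tetrahedronVertex_eq_or_adj hm2 hw⟩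
    · rintro v (rfl | rfl) <;> rw [Fin.forall_fin_two]
      · exact ⟨hc₀ z hz₀, hc₁ z hz₁⟩
      · exact ⟨hc₀ z' hz₀', hc₁ z' hz₁'⟩
  exact hevasive.not_copWins ⟨_, hpair 0 0 1 (by simp), 0, Set.pair_subset ⟨0, rfl⟩ ⟨1, rfl⟩⟩
    (fun S _ => S.toFinite) fun S hS => hS.1

end HeightFour

section ThreeByThree

/-- The number of coordinates in which two vertices differ: their distance on `C_3 □ C_3`, which is
the `3 × 3` rook's graph. -/
def rookDist (u v : Fin 3 × Fin 3) : ℕ :=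
  (if u.1 = v.1 then 0 else 1) + if u.2 = v.2 then 0 else 1

lemma torus_three_dist (u v : Fin 3 × Fin 3) : (torus 3 3).dist u v = rookDist u v := by
  rw [← Nat.cast_inj (R := ℕ∞), (torus_connected _ _).coe_dist_eq_edist, edist_boxProd,
    cycleGraph_three_eq_top, edist_top, edist_top, rookDist]
  split_ifs <;> rfl

theorem copWins_three_torus_three : (torus 3 3).CopWins 3 := by
  have hresolving : ∀ u v : Fin 3 × Fin 3, rookDist u (0, 0) = rookDist v (0, 0) →
      rookDist u (0, 1) = rookDist v (0, 1) → rookDist u (1, 0) = rookDist v (1, 0) → u = v := by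
    decide +kernel
  refine (copWinsFrom_of_injOn ![(0, 0), (0, 1), (1, 0)] fun u _ v _ he => ?_).copWins
  simp only [torus_three_dist] at he
  exact hresolving u v (congrFun he 0) (congrFun he 1) (congrFun he 2)

lemma seven_le_card_rookDist_le_one : ∀ u w : Fin 3 × Fin 3, u ≠ w →
    7 ≤ (Finset.univ.filter fun v => rookDist u v ≤ 1 ∨ rookDist w v ≤ 1).card := by
  decide +kernel

lemma card_image_rookDist_le_six : ∀ p q : Fin 3 × Fin 3,
    (Finset.univ.image fun v => (rookDist v p, rookDist v q)).card ≤ 6 := by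
  decide +kernel

theorem not_copWins_two_torus_three : ¬ (torus 3 3).CopWins 2 := by
  have hevasive : IsEvasive (torus 3 3) 2 {S | S.Nontrivial} := by
    rintro S ⟨u, hu, w, hw, huw⟩ p
    have hball : ∀ x ∈ S, ∀ v, rookDist x v ≤ 1 → v ∈ closedNeighborSet (torus 3 3) S := by
      intro x hx v h
      rw [← torus_three_dist] at h
      rcases Nat.le_one_iff_eq_zero_or_eq_one.mp h with h | h
      · exact ⟨x, hx, .inl (torus_connected.dist_eq_zero_iff.mp h).symm⟩
      · exact ⟨x, hx, .inr (dist_eq_one_iff_adj.mp h)⟩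
    obtain ⟨v, hv, v', hv', hne, he⟩ := Finset.exists_ne_map_eq_of_card_lt_of_maps_to
      (((card_image_rookDist_le_six (p 0) (p 1)).trans_lt (by simp)).trans_le
        (seven_le_card_rookDist_le_one u w huw))
      (fun v _ => Finset.mem_image_of_mem (fun v => (rookDist v (p 0), rookDist v (p 1)))
        (Finset.mem_univ v))
    have hmem : ∀ v ∈ Finset.univ.filter fun v => rookDist u v ≤ 1 ∨ rookDist w v ≤ 1,
        v ∈ closedNeighborSet (torus 3 3) S := fun v hv =>
      (Finset.mem_filter.mp hv).2.elim (hball u hu v) (hball w hw v)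
    refine ⟨{v, v'}, Set.nontrivial_pair hne, Set.pair_subset (hmem v hv) (hmem v' hv'),
      fun i => rookDist v (p i), ?_⟩
    obtain ⟨he₀, he₁⟩ := Prod.ext_iff.mp he
    rintro x (rfl | rfl) <;> rw [Fin.forall_fin_two, torus_three_dist, torus_three_dist]
    · exact ⟨rfl, rfl⟩
    · exact ⟨he₀.symm, he₁.symm⟩
  exact hevasive.not_copWins ⟨Set.univ, Set.nontrivial_univ⟩ (fun S _ => S.toFinite) fun S hS => hS

end ThreeByThree

theorem copWins_two_torus {m n : ℕ} [NeZero m] [NeZero n] (hn : 3 ≤ n) (hmn : n ≤ m)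
    (h : ¬ ((m = 3 ∧ n = 3) ∨ (Even m ∧ n = 4))) : (torus m n).CopWins 2 := by
  rcases Nat.even_or_odd n with hn' | hn'
  · have := hn'.two_dvd
    rcases Nat.even_or_odd m with hm | hm
    · have hn4 : n ≠ 4 := fun hn4 => h (.inr ⟨hm, hn4⟩)
      have := hm.two_dvd
      exact copWins_two_torus_of_even hm hn' (by omega) (by omega)
    · exact copWins_two_torus_of_odd hm (by omega) (by omega)
  · have hm4 : 4 ≤ m := by omega
    exact copWins_of_iso (boxProdComm _ _) (copWins_two_torus_of_odd hn' hn hm4)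

end LocalizationGame

open LocalizationGame

theorem theorem5p2 (m n : ℕ) (hn : 3 ≤ n) (hmn : n ≤ m) :
    (((m = 3 ∧ n = 3) ∨ (Even m ∧ n = 4)) →
      (SimpleGraph.boxProd (SimpleGraph.cycleGraph m)
        (SimpleGraph.cycleGraph n)).localizationNumber = 3) ∧
    (¬ ((m = 3 ∧ n = 3) ∨ (Even m ∧ n = 4)) →
      (SimpleGraph.boxProd (SimpleGraph.cycleGraph m)
        (SimpleGraph.cycleGraph n)).localizationNumber = 2) := by
  have : NeZero m := ⟨by omega⟩
  have : NeZero n := ⟨by omega⟩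
  have hone : ¬ (torus m n).CopWins 1 := not_copWins_one_torus (hn.trans hmn) hn
  constructor
  · intro h
    have htwo : ¬ (torus m n).CopWins 2 ∧ (torus m n).CopWins 3 := by
      rcases h with ⟨rfl, rfl⟩ | ⟨hm, rfl⟩
      · exact ⟨not_copWins_two_torus_three, copWins_three_torus_three⟩
      · exact ⟨not_copWins_two_torus_four hm, copWins_three_torus_of_even hm hmn hn⟩
    refine localizationNumber_eq three_pos htwo.2 fun k hk hk3 => ?_
    interval_cases k
    · exact hone
    · exact htwo.1
  · intro h
    refine localizationNumber_eq two_pos (copWins_two_torus hn hmn h) fun k hk hk2 => ?_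
    interval_cases k
    exact hone
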